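/- Let $\mathbb{F}_q$ be a finite field with $q=p^r$ elements, where $p$ is an odd prime. Let $s$ be a divisor of $r$ and let $\theta$ be an automorphism of $\mathbb{F}_q$ whose fixed field is $\mathbb{F}_{p^s}$, i.e. $\theta(x)=x \iff x^{p^s}=x$. Let $R_q=\mathbb{F}_q[v]/\langle v^q-v\rangle$. For $\alpha\in\mathbb{F}_q$ let $\phi_\alpha:R_q\to\mathbb{F}_q$ be the evaluation $v\mapsto\alpha$; these maps together give a ring isomorphism $R_q\cong\mathbb{F}_q^{\,q}$. Let $\eta_\alpha\in R_q$ be the idempotent with $\phi_\alpha(\eta_\alpha)=1$ and $\phi_\beta(\eta_\alpha)=0$ for $\beta\ne\alpha$, and let $\Theta_\theta$ be the automorphism $\sum_\alpha a_\alpha\eta_\alpha\mapsto\sum_\alpha\theta(a_\alpha)\eta_\alpha$ of $R_q$ (with $a_\alpha\in\mathbb{F}_q$). A linear code of length $n\ge 1$ over $R_q$ is an $R_q$-submodule $C\subseteq R_q^n$. It is self-dual if $C=C^\perp:=\{a\in R_q^n:\ \sum_i a_ib_i=0\text{ for all }b\in C\}$. It is skew $\Theta_\theta$-cyclic (respectively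 skew $\Theta_\theta$-negacyclic) if $T_\lambda(C)=C$ for $\lambda=1$ (respectively $\lambda=-1$), where $$T_\lambda(a_0,a_1,\dots,a_{n-1})=(\lambda\,\Theta_\theta(a_{n-1}),\Theta_\theta(a_0),\dots,\Theta_\theta(a_{n-2})).$$ Its dimension is $\max_{\alpha\in\mathbb{F}_q}\dim_{\mathbb{F}_q}C_\alpha$, where $C_\alpha\subseteq\mathbb{F}_q^n$ is the image of $C$ under $\phi_\alpha$ applied to every coordinate. Let $k\ge 1$ be an integer; below, a code of dimension $k$ may have any length $n\ge1$. 1. If $q\equiv 1 \pmod 4$, then: (i) there exists a self-dual skew $\Theta_\theta$-cyclic code of dimension $k$ over $R_q$ if and only if $p\equiv 3\pmod 4$, $r$ is even and $sk$ is odd; (ii) there exists a self-dual skew $\Theta_\theta$-negacyclic code of dimension $k$ over $R_q$ if and only if either $p\equiv 1\pmod 4$, or $p\equiv 3\pmod 4$, $r$ is even and $sk$ is even. 2. If $q\equiv 3\pmod 4$, then: (i) there does not exist a self-dual skew $\Theta_\theta$-cyclic code of dimension $k$ over $R_q$; (ii) the biggest integer $\mu$ such that $2^\mu$ divides $p+1$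 satisfies $\mu\ge2$, and there exists a self-dual skew $\Theta_\theta$-negacyclic code of dimension $k$ over $R_q$ if and only if $k\equiv 0\pmod{2^{\mu-1}}$. -/

import Mathlib

namespace SkewCode

open Polynomial

noncomputable section

/-! ### Linear codes over a commutative ring -/

section Codes

variable {R : Type*} [CommRing R] {n : ℕ}

/-- The Euclidean dual `{a : a ⬝ b = 0 for all b ∈ C}` of a linear code `C ⊆ Rⁿ`. -/
def dualCode (C : Submodule R (Fin n → R)) : Submodule R (Fin n → R) where
  carrier := {a | ∀ b ∈ C, a ⬝ᵥ b = 0}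
  zero_mem' := fun b _ => zero_dotProduct b
  add_mem' := fun {a a'} ha ha' b hb => by rw [add_dotProduct, ha b hb, ha' b hb, add_zero]
  smul_mem' := fun c a ha b hb => by rw [smul_dotProduct, ha b hb, smul_zero]

/-- A linear code is self-dual if it is equal to its Euclidean dual. -/
def IsSelfDual (C : Submodule R (Fin n → R)) : Prop := dualCode C = C

/-- The skew constacyclic shift
`(a₀, a₁, …, aₙ₋₁) ↦ (lam * Θ aₙ₋₁, Θ a₀, …, Θ aₙ₋₂)` on `Rⁿ`, `n ≥ 1`.
The subtraction `j - 1` is the cyclic one of `Fin n`, so that `0 - 1` is the last index. -/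
def constaShift [NeZero n] (Θ : R ≃+* R) (lam : R) (a : Fin n → R) : Fin n → R :=
  fun j => if j = 0 then lam * Θ (a (j - 1)) else Θ (a (j - 1))

/-- A linear code is skew `Θ`-`lam`-constacyclic if it is mapped onto itself by the shift. -/
def IsSkewConstacyclic [NeZero n] (Θ : R ≃+* R) (lam : Rˣ) (C : Submodule R (Fin n → R)) : Prop :=
  constaShift Θ (lam : R) '' (C : Set (Fin n → R)) = C

/-- Skew cyclic codes: `lam = 1`. -/
def IsSkewCyclic [NeZero n] (Θ : R ≃+* R) (C : Submodule R (Fin n → R)) : Prop :=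
  IsSkewConstacyclic Θ 1 C

/-- Skew negacyclic codes: `lam = -1`. -/
def IsSkewNegacyclic [NeZero n] (Θ : R ≃+* R) (C : Submodule R (Fin n → R)) : Prop :=
  IsSkewConstacyclic Θ (-1) C

end Codes

/-! ### The ring `R_q = F_q[v] / (v^q - v)` -/

section Ring

variable (F : Type*) [Field F]

/-- The ring `F[v] / (v^q - v)`, where `q` is the number of elements of `F`. -/
abbrev Rq : Type _ := AdjoinRoot (X ^ Nat.card F - X : F[X])

variable {F} [Finite F]

theorem eval_modulus (α : F) : eval₂ (Algebra.ofId F F) α (X ^ Nat.card F - X : F[X]) = 0 := by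
  cases nonempty_fintype F
  simp [Nat.card_eq_fintype_card, FiniteField.pow_card]

/-- The component `φ_α : R_q → F`, evaluation of the variable `v` at `α ∈ F`. -/
def phi (α : F) : Rq F →ₐ[F] F :=
  AdjoinRoot.liftAlgHom (X ^ Nat.card F - X : F[X]) (Algebra.ofId F F) α (eval_modulus α)

theorem phi_mk (α : F) (f : F[X]) : phi α (AdjoinRoot.mk _ f) = f.eval α :=
  AdjoinRoot.lift_mk (eval_modulus α) f

theorem pi_phi_bijective :
    Function.Bijective (AlgHom.pi (fun α : F => phi α) : Rq F →ₐ[F] (F → F)) := by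
  classical
  cases nonempty_fintype F
  have hcard : 1 < Nat.card F := Finite.one_lt_card
  have hne : (X ^ Nat.card F - X : F[X]) ≠ 0 := FiniteField.X_pow_card_sub_X_ne_zero F hcard
  have hsurj : Function.Surjective
      (AlgHom.pi (fun α : F => phi α) : Rq F →ₐ[F] (F → F)) := by
    intro y
    refine ⟨AdjoinRoot.mk _ (Lagrange.interpolate Finset.univ id y), ?_⟩
    funext α
    have h := Lagrange.eval_interpolate_at_node (s := Finset.univ) (v := id) y
      (Set.injOn_id _) (Finset.mem_univ α)
    exact (phi_mk α _).trans h
  have : FiniteDimensional F (Rq F) := (AdjoinRoot.powerBasis hne).finite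
  have hrank : Module.finrank F (Rq F) = Module.finrank F (F → F) := by
    rw [(AdjoinRoot.powerBasis hne).finrank, AdjoinRoot.powerBasis_dim,
      FiniteField.X_pow_card_sub_X_natDegree_eq F hcard, Module.finrank_fintype_fun_eq_card,
      Nat.card_eq_fintype_card]
  exact ⟨(LinearMap.injective_iff_surjective_of_finrank_eq_finrank
    (f := (AlgHom.pi (fun α : F => phi α) : Rq F →ₐ[F] (F → F)).toLinearMap)
    hrank).2 hsurj, hsurj⟩

/-- The Chinese remainder isomorphism `φ : R_q ≃ F^q`, `a ↦ (φ_α a)_{α ∈ F}`. -/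
def phiEquiv : Rq F ≃ₐ[F] (F → F) :=
  AlgEquiv.ofBijective (AlgHom.pi (fun α : F => phi α)) pi_phi_bijective

open Classical in
/-- The primitive idempotents `η_α` (`α ∈ F`) of `R_q`: the component of `η_α` at `α` is `1`
and its other components are `0`. -/
def eta (α : F) : Rq F := phiEquiv.symm (Pi.single α 1)

/-- The automorphism `Θ_θ` of `R_q`, which applies `θ` to every component of an element;
it maps `∑ a_α η_α` to `∑ θ(a_α) η_α`, see `Theta_sum`. -/
def Theta (θ : F ≃+* F) : Rq F ≃+* Rq F :=
  ((phiEquiv (F := F)).toRingEquiv.trans (RingEquiv.piCongrRight fun _ : F => θ)).trans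
    (phiEquiv (F := F)).symm.toRingEquiv

theorem phi_Theta (θ : F ≃+* F) (a : Rq F) (α : F) : phi α (Theta θ a) = θ (phi α a) :=
  congrFun (phiEquiv.apply_symm_apply (fun β => θ (phi β a))) α

theorem phi_sum_eta [Fintype F] (a : F → F) (α : F) :
    phi α (∑ β, a β • eta β) = a α := by
  classical
  have h : ∀ β, phi α (eta β) = (Pi.single β (1 : F) : F → F) α := fun β => by
    refine (congrFun (phiEquiv.apply_symm_apply _) α).trans ?_
    congr!
  simp [h, Pi.single_apply]

theorem Theta_sum [Fintype F] (θ : F ≃+* F) (a : F → F) :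
    Theta θ (∑ α, a α • eta α) = ∑ α, θ (a α) • eta α := by
  apply phiEquiv.injective
  funext α
  exact (phi_Theta θ _ α).trans
    ((congrArg θ (phi_sum_eta a α)).trans (phi_sum_eta (fun β => θ (a β)) α).symm)

variable {n : ℕ}

/-- The component `C_α = Φ_α(C) ⊆ Fⁿ` of a linear code `C ⊆ R_qⁿ`, where `Φ_α` applies `φ_α` to
every coordinate. -/
def component (C : Submodule (Rq F) (Fin n → Rq F)) (α : F) : Submodule F (Fin n → F) :=
  (C.restrictScalars F).map ((phi α).toLinearMap.compLeft (Fin n))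

/-- The dimension (rank) of a linear code `C` over `R_q`: the largest of the dimensions over `F`
of its components `C_α`, `α ∈ F`. -/
def codeDim (C : Submodule (Rq F) (Fin n → Rq F)) : ℕ :=
  ⨆ α : F, Module.finrank F (component C α)

/-- There is a self-dual skew `Θ_θ`-cyclic code of dimension `k`, of some length `n ≥ 1`,
over `R_q`. -/
def ExistsSelfDualSkewCyclic (θ : F ≃+* F) (k : ℕ) : Prop :=
  ∃ (n : ℕ) (_ : NeZero n) (C : Submodule (Rq F) (Fin n → Rq F)),
    IsSelfDual C ∧ IsSkewCyclic (Theta θ) C ∧ codeDim C = k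

/-- There is a self-dual skew `Θ_θ`-negacyclic code of dimension `k`, of some length `n ≥ 1`,
over `R_q`. -/
def ExistsSelfDualSkewNegacyclic (θ : F ≃+* F) (k : ℕ) : Prop :=
  ∃ (n : ℕ) (_ : NeZero n) (C : Submodule (Rq F) (Fin n → Rq F)),
    IsSelfDual C ∧ IsSkewNegacyclic (Theta θ) C ∧ codeDim C = k

end Ring

end

end SkewCode

/-! By the Chinese remainder theorem every component of a self-dual code over `Rq F` is self-dual of
dimension half the length. So everything reduces to self-dual skew constacyclic codes of length `2 *
k` over `F`, with shift matrix `P` satisfying `P ^ (2 * k) = lam`.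

Codes are built as the 1-eigenspace of a skew-symmetric involution commuting with the semilinear
shift (`exists_selfDual_of_skew_involution`). If `i ^ 2 = -1`, take `i P ^ k` when `θ` fixes `i`,
and `i P ^ k A` with `A = diag(1, -1, 1, …)` when `θ i = -i`. If `2 ^ μ` exactly divides `p + 1`, `2
≤ μ` and the length is `2 ^ μ * l`, take `(N - Nᵀ) ^ ((p - 1) / 2)` with `N = P ^ l`.

There are two obstructions. A self-dual code is the graph of some `B` with `Bᵀ B = -1`, and shift
stability forces `det P * θ (det B) = det B` (`IsSelfDual.exists_sq_eq_of_isShiftStable`). As `det B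
= ± i ^ k` when `i` exists, this settles `q ≡ 1 mod 4`.

For `q ≡ 3 mod 4`, `r` is odd. Writing `2 * k = 2 ^ (a + 1) * k'` with `k'` odd, a power of the
semilinear shift acts as the linear map `P ^ k'`. Over an extension containing `z` with `z ^ 2 ^ (a
+ 1) = lam` and `z ^ q = z⁻¹`, Frobenius exchanges the parts of the code in the `z`- and
`z⁻¹`-eigenspaces, while duality makes their dimensions add up to `k'`, which is odd
(`not_isSelfDual_of_odd`). -/

namespace SkewCode

open Matrix

/-! ### Dimension of the dual code. -/

section Duality

variable {K : Type*} [Field K] {n : ℕ}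

theorem mem_dualCode {R : Type*} [CommRing R] {C : Submodule R (Fin n → R)} {a : Fin n → R} :
    a ∈ dualCode C ↔ ∀ b ∈ C, a ⬝ᵥ b = 0 := Iff.rfl

theorem finrank_add_finrank_dualCode (C : Submodule K (Fin n → K)) :
    Module.finrank K C + Module.finrank K (dualCode C) = n := by
  have h : dualCode C = C.dualAnnihilator.comap (dotProductEquiv K (Fin n)).toLinearMap := by
    ext a
    simp [mem_dualCode, Submodule.mem_dualAnnihilator]
  have h2 := Subspace.finrank_add_finrank_dualAnnihilator_eq C
  rw [h, ((dotProductEquiv K (Fin n)).ofSubmodule' C.dualAnnihilator).finrank_eq, h2]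
  simp

theorem IsSelfDual.two_mul_finrank {C : Submodule K (Fin n → K)} (h : IsSelfDual C) :
    2 * Module.finrank K C = n := by
  have h2 := finrank_add_finrank_dualCode C
  rw [h] at h2
  lia

end Duality

/-! ### Stability under the shift. -/

section Shift

variable {R : Type*} [CommRing R] {n : ℕ} [NeZero n]

/-- Stability of a linear code under the skew constacyclic shift. -/
def IsShiftStable (θ : R ≃+* R) (lam : R) (C : Submodule R (Fin n → R)) : Prop :=
  ∀ a ∈ C, constaShift θ lam a ∈ C

theorem constaShift_injective (θ : R ≃+* R) (lam : Rˣ) :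
    Function.Injective (constaShift (n := n) θ (lam : R)) := by
  intro a b h
  funext j
  have h1 := congrFun h (j + 1)
  simp only [constaShift, add_sub_cancel_right] at h1
  split_ifs at h1
  · simpa using h1
  · simpa using h1

/-- The shift is injective and the code finite, so mapping into the code already means mapping onto
it. -/
theorem isSkewConstacyclic_iff [Finite R] (θ : R ≃+* R) (lam : Rˣ)
    (C : Submodule R (Fin n → R)) :
    IsSkewConstacyclic θ lam C ↔ IsShiftStable θ (lam : R) C := by
  constructor
  · intro h a ha
    have : constaShift θ (lam : R) a ∈ constaShift θ (lam : R) '' (C : Set (Fin n → R)) :=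
      ⟨a, ha, rfl⟩
    rwa [h] at this
  · intro h
    refine Set.eq_of_subset_of_ncard_le (Set.image_subset_iff.2 h) ?_ (Set.toFinite _)
    rw [Set.ncard_image_of_injective _ (constaShift_injective θ lam)]

end Shift

/-! ### Reduction from `Rq F` to `F`. -/

section Components

variable {F : Type*} [Field F] [Finite F] {n : ℕ}

instance : Finite (Rq F) := Finite.of_equiv _ (phiEquiv (F := F)).symm.toEquiv

theorem phi_ext {a b : Rq F} (h : ∀ α, phi α a = phi α b) : a = b :=
  pi_phi_bijective.1 (funext h)

theorem phi_dotProduct (α : F) (a b : Fin n → Rq F) :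
    phi α (a ⬝ᵥ b) = (fun i => phi α (a i)) ⬝ᵥ fun i => phi α (b i) := by
  simp [dotProduct]

theorem phi_constaShift [NeZero n] (θ : F ≃+* F) (lam : Rq F) (a : Fin n → Rq F) (α : F) :
    (fun i => phi α (constaShift (Theta θ) lam a i)) =
      constaShift θ (phi α lam) fun i => phi α (a i) := by
  funext i
  simp only [constaShift]
  split_ifs <;> simp [phi_Theta]

theorem mem_component {C : Submodule (Rq F) (Fin n → Rq F)} {α : F} {x : Fin n → F} :
    x ∈ component C α ↔ ∃ a ∈ C, (fun i => phi α (a i)) = x := by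
  rfl

theorem exists_lift (α : F) (x : Fin n → F) :
    ∃ a : Fin n → Rq F, (fun i => phi α (a i)) = x ∧ ∀ β, β ≠ α → ∀ i, phi β (a i) = 0 := by
  classical
  have h : ∀ (y : F → F) β, phi β (phiEquiv.symm y) = y β := fun y β =>
    congrFun (phiEquiv.apply_symm_apply y) β
  refine ⟨fun i => phiEquiv.symm (Pi.single α (x i)), ?_, fun β hβ i => ?_⟩
  · funext i
    rw [h, Pi.single_eq_same]
  · rw [h, Pi.single_eq_of_ne hβ]

theorem dotProduct_lift {α : F} {a b : Fin n → Rq F} (h : ∀ β, β ≠ α → ∀ i, phi β (a i) = 0)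
    (h' : (fun i => phi α (a i)) ⬝ᵥ (fun i => phi α (b i)) = 0) : a ⬝ᵥ b = 0 := by
  refine phi_ext fun β => ?_
  rw [phi_dotProduct, map_zero]
  by_cases hβ : β = α
  · rw [hβ, h']
  · simp [dotProduct, h β hβ]

theorem isSelfDual_component {C : Submodule (Rq F) (Fin n → Rq F)} (hC : IsSelfDual C) (α : F) :
    IsSelfDual (component C α) := by
  ext x
  constructor
  · intro hx
    obtain ⟨a, rfl, ha⟩ := exists_lift α x
    refine mem_component.2 ⟨a, ?_, rfl⟩
    rw [← hC]
    exact fun b hb => dotProduct_lift ha (hx _ (mem_component.2 ⟨b, hb, rfl⟩))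
  · rintro hx y hy
    obtain ⟨a, ha, rfl⟩ := mem_component.1 hx
    obtain ⟨b, hb, rfl⟩ := mem_component.1 hy
    rw [← hC] at ha
    rw [← phi_dotProduct, ha b hb, map_zero]

/-- The code over `R_q` all of whose components are equal to `D`. -/
def diagonalCode (D : Submodule F (Fin n → F)) : Submodule (Rq F) (Fin n → Rq F) where
  carrier := {a | ∀ α, (fun i => phi α (a i)) ∈ D}
  zero_mem' := fun α => by
    convert D.zero_mem using 1
    funext i
    simp
  add_mem' := fun {a b} ha hb α => by
    convert D.add_mem (ha α) (hb α) using 1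
    funext i
    simp
  smul_mem' := fun c a ha α => by
    convert D.smul_mem (phi α c) (ha α) using 1
    funext i
    simp

theorem component_diagonalCode (D : Submodule F (Fin n → F)) (α : F) :
    component (diagonalCode D) α = D := by
  ext x
  rw [mem_component]
  constructor
  · rintro ⟨a, ha, rfl⟩
    exact ha α
  · intro hx
    obtain ⟨a, rfl, ha⟩ := exists_lift α x
    refine ⟨a, fun β => ?_, rfl⟩
    by_cases hβ : β = α
    · rwa [hβ]
    · convert D.zero_mem using 1
      funext i
      exact ha β hβ i

theorem isSelfDual_diagonalCode {D : Submodule F (Fin n → F)} (hD : IsSelfDual D) :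
    IsSelfDual (diagonalCode D) := by
  ext a
  constructor
  · intro h α
    rw [← hD]
    intro y hy
    rw [← component_diagonalCode D α] at hy
    obtain ⟨b, hb, rfl⟩ := mem_component.1 hy
    rw [← phi_dotProduct, h b hb, map_zero]
  · intro ha b hb
    refine phi_ext fun α => ?_
    have := ha α
    rw [← hD] at this
    rw [phi_dotProduct, map_zero, this _ (hb α)]

/-- Self-duality gives all components the same dimension `n / 2`, so the supremum in `codeDim` is
that number and fixes the length. One component suffices in one direction, the diagonal code in the
other. -/
theorem exists_selfDual_skewConstacyclic_iff (θ : F ≃+* F) (u : (Rq F)ˣ) (lam : F)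
    (hu : ∀ α, phi α (u : Rq F) = lam) (k : ℕ) [NeZero (2 * k)] :
    (∃ (n : ℕ) (_ : NeZero n) (C : Submodule (Rq F) (Fin n → Rq F)),
      IsSelfDual C ∧ IsSkewConstacyclic (Theta θ) u C ∧ codeDim C = k) ↔
    ∃ D : Submodule F (Fin (2 * k) → F), IsSelfDual D ∧ IsShiftStable θ lam D := by
  constructor
  · rintro ⟨n, hn, C, hC, hs, hk⟩
    have hdim : ∀ α, Module.finrank F (component C α) = k := by
      intro α
      have h : ∀ β, Module.finrank F (component C β) = Module.finrank F (component C α) := by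
        intro β
        have h1 := (isSelfDual_component hC α).two_mul_finrank
        have h2 := (isSelfDual_component hC β).two_mul_finrank
        lia
      rw [← hk, codeDim, funext h, ciSup_const]
    obtain rfl : 2 * k = n := by
      rw [← hdim 0, (isSelfDual_component hC 0).two_mul_finrank]
    refine ⟨component C 0, isSelfDual_component hC 0, fun x hx => ?_⟩
    obtain ⟨a, ha, rfl⟩ := mem_component.1 hx
    rw [← hu 0, ← phi_constaShift]
    exact mem_component.2 ⟨_, (isSkewConstacyclic_iff _ _ _).1 hs a ha, rfl⟩
  · rintro ⟨D, hD, hs⟩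
    refine ⟨2 * k, inferInstance, diagonalCode D, isSelfDual_diagonalCode hD,
      (isSkewConstacyclic_iff _ _ _).2 fun a ha α => ?_, ?_⟩
    · rw [phi_constaShift, hu]
      exact hs _ (ha α)
    · have h : ∀ α, Module.finrank F (component (diagonalCode D) α) = k := fun α => by
        have := hD.two_mul_finrank
        rw [component_diagonalCode]
        lia
      rw [codeDim, funext h, ciSup_const]

theorem existsSelfDualSkewCyclic_iff (θ : F ≃+* F) (k : ℕ) [NeZero (2 * k)] :
    ExistsSelfDualSkewCyclic θ k ↔
      ∃ D : Submodule F (Fin (2 * k) → F), IsSelfDual D ∧ IsShiftStable θ 1 D :=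
  exists_selfDual_skewConstacyclic_iff θ 1 1 (by simp) k

theorem existsSelfDualSkewNegacyclic_iff (θ : F ≃+* F) (k : ℕ) [NeZero (2 * k)] :
    ExistsSelfDualSkewNegacyclic θ k ↔
      ∃ D : Submodule F (Fin (2 * k) → F), IsSelfDual D ∧ IsShiftStable θ (-1) D :=
  exists_selfDual_skewConstacyclic_iff θ (-1) (-1) (by simp) k

end Components

/-! ### Matrix algebra of the constacyclic shift. -/

section ShiftMatrix

/-- The diagonal matrix with alternating entries `1, -1, 1, …`. -/
def alternatingMatrix (R : Type*) [CommRing R] (n : ℕ) : Matrix (Fin n) (Fin n) R :=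
  diagonal fun j => (-1) ^ (j : ℕ)

theorem alternatingMatrix_mul_self {R : Type*} [CommRing R] {n : ℕ} :
    alternatingMatrix R n * alternatingMatrix R n = 1 := by
  rw [alternatingMatrix, diagonal_mul_diagonal, ← diagonal_one]
  congr 1
  funext j
  rw [← mul_pow]
  simp

variable {R : Type*} [CommRing R] {n : ℕ} [NeZero n]

/-- The matrix of the linear constacyclic shift on `Rⁿ`. -/
def shiftMatrix (n : ℕ) [NeZero n] (lam : R) : Matrix (Fin n) (Fin n) R :=
  Matrix.of fun j l => if l = j - 1 then (if j = 0 then lam else 1) else 0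

theorem shiftMatrix_mulVec (lam : R) (v : Fin n → R) (j : Fin n) :
    (shiftMatrix n lam *ᵥ v) j = (if j = 0 then lam else 1) * v (j - 1) := by
  simp [shiftMatrix, mulVec, dotProduct]

theorem constaShift_eq (θ : R ≃+* R) (lam : R) (a : Fin n → R) :
    constaShift θ lam a = shiftMatrix n lam *ᵥ (θ ∘ a) := by
  funext j
  rw [shiftMatrix_mulVec]
  simp only [constaShift]
  split_ifs <;> simp

theorem mapMatrix_shiftMatrix {S : Type*} [CommRing S] (f : R →+* S) (lam : R) :
    f.mapMatrix (shiftMatrix n lam) = shiftMatrix n (f lam) := by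
  ext i j
  simp only [shiftMatrix, RingHom.mapMatrix_apply, map_apply, of_apply]
  split_ifs <;> simp

theorem shiftMatrix_transpose_mul_self {lam : R} (h : lam * lam = 1) :
    (shiftMatrix n lam)ᵀ * shiftMatrix n lam = 1 := by
  ext i j
  rw [mul_apply, Finset.sum_eq_single (i + 1)]
  · simp only [shiftMatrix, transpose_apply, of_apply, add_sub_cancel_right, one_apply]
    by_cases hij : i = j
    · subst hij
      split_ifs <;> simp [h]
    · simp [hij, Ne.symm hij]
  · intro b _ hb
    have : i ≠ b - 1 := fun h => hb (by rw [h, sub_add_cancel])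
    simp [shiftMatrix, this]
  · simp

theorem shiftMatrix_mul_transpose_self {lam : R} (h : lam * lam = 1) :
    shiftMatrix n lam * (shiftMatrix n lam)ᵀ = 1 :=
  mul_eq_one_comm.1 (shiftMatrix_transpose_mul_self h)

theorem shiftMatrix_pow_transpose_mul_self {lam : R} (h : lam * lam = 1) (t : ℕ) :
    (shiftMatrix n lam ^ t)ᵀ * shiftMatrix n lam ^ t = 1 := by
  have h1 := shiftMatrix_transpose_mul_self (n := n) h
  rw [transpose_pow, ← Commute.mul_pow (h1.trans (shiftMatrix_mul_transpose_self h).symm), h1,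
    one_pow]

theorem val_sub_one_of_eq_zero {j : Fin n} (h : j = 0) : ((j - 1 : Fin n) : ℕ) + 1 = n := by
  subst h
  obtain ⟨m, rfl⟩ := Nat.exists_eq_succ_of_ne_zero (NeZero.ne n)
  simp

theorem val_sub_one_of_ne_zero {j : Fin n} (h : j ≠ 0) : ((j - 1 : Fin n) : ℕ) + 1 = j := by
  rw [Fin.val_sub_one_of_ne_zero h]
  have : (j : ℕ) ≠ 0 := fun h' => h (Fin.ext (by simpa using h'))
  lia

/-- For `t ≤ n` an entry wraps around at most once; the two clauses separate entries that have not
wrapped from those that have and so picked up one factor `lam`. -/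
theorem shiftMatrix_pow_mulVec (lam : R) (v : Fin n → R) (t : ℕ) (ht : t ≤ n) :
    (∀ j l : Fin n, (l : ℕ) + t = j → (shiftMatrix n lam ^ t *ᵥ v) j = v l) ∧
    ∀ j l : Fin n, (l : ℕ) + t = j + n → (shiftMatrix n lam ^ t *ᵥ v) j = lam * v l := by
  induction t with
  | zero =>
    refine ⟨fun j l h => ?_, fun j l h => ?_⟩
    · obtain rfl : l = j := Fin.ext (by simpa using h)
      rw [pow_zero, one_mulVec]
    · have := l.2
      lia
  | succ t ih =>
    obtain ⟨ih1, ih2⟩ := ih (by lia)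
    have key : ∀ j, (shiftMatrix n lam ^ (t + 1) *ᵥ v) j =
        (if j = 0 then lam else 1) * (shiftMatrix n lam ^ t *ᵥ v) (j - 1) := by
      intro j
      rw [pow_succ', ← mulVec_mulVec, shiftMatrix_mulVec]
    refine ⟨fun j l h => ?_, fun j l h => ?_⟩
    · have hj : j ≠ 0 := by
        rintro rfl
        simp at h
      have := val_sub_one_of_ne_zero hj
      rw [key, if_neg hj, one_mul, ih1 _ l (by lia)]
    · by_cases hj : j = 0
      · have := val_sub_one_of_eq_zero hj
        have h0 : (j : ℕ) = 0 := by simp [hj]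
        rw [key, if_pos hj, ih1 _ l (by lia)]
      · have := val_sub_one_of_ne_zero hj
        rw [key, if_neg hj, one_mul, ih2 _ l (by lia)]

theorem shiftMatrix_pow_self (lam : R) :
    shiftMatrix n lam ^ n = lam • (1 : Matrix (Fin n) (Fin n) R) := by
  refine Matrix.ext_iff_mulVec.2 fun v => ?_
  funext j
  rw [(shiftMatrix_pow_mulVec lam v n le_rfl).2 j j rfl]
  simp [smul_mulVec]

/-- A shift by one place flips the alternating sign; evenness of `n` keeps this true at the
wrap-around. -/
theorem alternatingMatrix_mul_shiftMatrix (hn : Even n) (lam : R) :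
    alternatingMatrix R n * shiftMatrix n lam = -(shiftMatrix n lam * alternatingMatrix R n) := by
  ext j l
  rw [alternatingMatrix, neg_apply, diagonal_mul, mul_diagonal]
  simp only [shiftMatrix, of_apply]
  split_ifs with h1 h2
  · have h3 := val_sub_one_of_eq_zero h2
    rw [← h1] at h3
    have h4 : ((-1 : R)) ^ (l : ℕ) = -1 := Odd.neg_one_pow (by grind)
    rw [h4, h2]
    simp
  · have h3 := val_sub_one_of_ne_zero h2
    rw [← h1] at h3
    rw [← h3, pow_succ]
    ring
  · simp

theorem alternatingMatrix_mul_shiftMatrix_pow (hn : Even n) (lam : R) (t : ℕ) :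
    alternatingMatrix R n * shiftMatrix n lam ^ t =
      (-1 : R) ^ t • (shiftMatrix n lam ^ t * alternatingMatrix R n) := by
  induction t with
  | zero => simp
  | succ t ih =>
    rw [pow_succ, ← mul_assoc, ih, smul_mul_assoc, mul_assoc,
      alternatingMatrix_mul_shiftMatrix hn, pow_succ]
    simp [mul_assoc]

end ShiftMatrix

/-! ### Self-dual codes from skew-symmetric involutions. -/

section Projector

variable {K : Type*} [Field K] {n : ℕ} [NeZero n]

/-- The code is the 1-eigenspace of `u`. Skew-symmetry gives `a ⬝ b = -(a ⬝ b)` on it, and a vector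
orthogonal to every `u x + x` is fixed by `u`. -/
theorem exists_selfDual_of_skew_involution (h2 : (2 : K) ≠ 0) (θ : K ≃+* K) (lam : K)
    (u : Matrix (Fin n) (Fin n) K) (hu : u * u = 1) (hut : uᵀ = -u)
    (hcomm : shiftMatrix n lam * (θ : K →+* K).mapMatrix u = u * shiftMatrix n lam) :
    ∃ D : Submodule K (Fin n → K), IsSelfDual D ∧ IsShiftStable θ lam D := by
  let D : Submodule K (Fin n → K) :=
    { carrier := {a | u *ᵥ a = a}
      zero_mem' := mulVec_zero u
      add_mem' := fun {a b} ha hb => by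
        rw [Set.mem_ofPred_eq] at ha hb ⊢
        rw [mulVec_add, ha, hb]
      smul_mem' := fun c a ha => by
        rw [Set.mem_ofPred_eq] at ha ⊢
        rw [mulVec_smul, ha] }
  have hD : ∀ a, a ∈ D ↔ u *ᵥ a = a := fun a => Iff.rfl
  have hskew : ∀ a b, (u *ᵥ a) ⬝ᵥ b = -(a ⬝ᵥ (u *ᵥ b)) := fun a b => by
    rw [dotProduct_comm, dotProduct_mulVec, ← mulVec_transpose, hut, neg_mulVec, neg_dotProduct,
      dotProduct_comm]
  refine ⟨D, ?_, fun a ha => ?_⟩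
  · ext a
    constructor
    · intro ha
      rw [hD, ← sub_eq_zero, ← neg_eq_zero, neg_sub]
      refine dotProduct_eq_zero _ fun x => ?_
      have h1 : u *ᵥ x + x ∈ D := by
        rw [hD, mulVec_add, mulVec_mulVec, hu, one_mulVec, add_comm]
      have h3 := ha _ h1
      rw [dotProduct_add] at h3
      rw [sub_dotProduct, hskew]
      linear_combination h3
    · intro ha b hb
      rw [hD] at ha hb
      have h1 := hskew a b
      rw [ha, hb] at h1
      have h3 : 2 * (a ⬝ᵥ b) = 0 := by linear_combination h1
      exact (mul_eq_zero.1 h3).resolve_left h2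
  · rw [hD] at ha ⊢
    have h1 : θ ∘ a = (θ : K →+* K).mapMatrix u *ᵥ (θ ∘ a) := by
      conv_lhs => rw [← ha]
      funext i
      exact RingHom.map_mulVec (θ : K →+* K) u a i
    rw [constaShift_eq, mulVec_mulVec, ← hcomm, ← mulVec_mulVec, ← h1]

/-- The transpose of the orthogonal matrix `P ^ k` is its inverse, and its square is `lam`. -/
theorem shiftMatrix_pow_half_transpose {lam : K} (h : lam * lam = 1) {k : ℕ} [NeZero (2 * k)] :
    (shiftMatrix (2 * k) lam ^ k)ᵀ = lam • shiftMatrix (2 * k) lam ^ k := by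
  set P := shiftMatrix (2 * k) lam with hP
  have hPn : P ^ k * P ^ k = lam • 1 := by
    rw [← pow_add, ← two_mul, hP, shiftMatrix_pow_self]
  calc (P ^ k)ᵀ = lam • ((P ^ k)ᵀ * (P ^ k * P ^ k)) := by
        rw [hPn, mul_smul_comm, smul_smul, h, mul_one, one_smul]
    _ = lam • P ^ k := by rw [← mul_assoc, hP, shiftMatrix_pow_transpose_mul_self h, one_mul]

theorem exists_selfDual_of_fixed_sqrt (h2 : (2 : K) ≠ 0) (θ : K ≃+* K) {i : K} (hi : i * i = -1)
    (hθ : θ i = i) (k : ℕ) [NeZero (2 * k)] :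
    ∃ D : Submodule K (Fin (2 * k) → K), IsSelfDual D ∧ IsShiftStable θ (-1) D := by
  refine exists_selfDual_of_skew_involution h2 θ (-1) (i • shiftMatrix (2 * k) (-1) ^ k) ?_ ?_ ?_
  · rw [smul_mul_smul_comm, ← pow_add, ← two_mul, shiftMatrix_pow_self, hi, smul_smul]
    simp
  · rw [transpose_smul, shiftMatrix_pow_half_transpose (by simp), smul_comm]
    simp
  · have h1 : (θ : K →+* K).mapMatrix (i • shiftMatrix (2 * k) (-1) ^ k) =
        i • shiftMatrix (2 * k) (-1) ^ k := by
      rw [smul_eq_diagonal_mul, map_mul, map_pow, mapMatrix_shiftMatrix]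
      simp [diagonal_map, hθ]
    rw [h1, mul_smul_comm, smul_mul_assoc, ← pow_succ, ← pow_succ']

/-- The anticommutation of `A` with `P` compensates `θ i = -i`. The value of `lam` is forced by `(i
P ^ k A) ^ 2 = -(-1) ^ k * lam`, which must be `1`. -/
theorem exists_selfDual_of_conjugated_sqrt (h2 : (2 : K) ≠ 0) (θ : K ≃+* K) {i : K}
    (hi : i * i = -1) (hθ : θ i = -i) (k : ℕ) [NeZero (2 * k)] :
    ∃ D : Submodule K (Fin (2 * k) → K),
      IsSelfDual D ∧ IsShiftStable θ ((-1) ^ (k + 1)) D := by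
  set lam : K := (-1) ^ (k + 1) with hlam
  have hlam2 : lam * lam = 1 := by
    rw [hlam, ← mul_pow]
    simp
  have hlamk : lam * (-1) ^ k = -1 := by
    rw [hlam, pow_succ, mul_right_comm, ← mul_pow]
    simp
  set P := shiftMatrix (2 * k) lam with hP
  set A := alternatingMatrix K (2 * k) with hA
  have hAP : A * P = -(P * A) := alternatingMatrix_mul_shiftMatrix (even_two_mul k) lam
  have hAPk : A * P ^ k = (-1 : K) ^ k • (P ^ k * A) :=
    alternatingMatrix_mul_shiftMatrix_pow (even_two_mul k) lam k
  have hAA : A * A = 1 := alternatingMatrix_mul_self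
  refine exists_selfDual_of_skew_involution h2 θ lam (i • (P ^ k * A)) ?_ ?_ ?_
  · rw [smul_mul_smul_comm, ← mul_assoc, mul_assoc (P ^ k) A, hAPk, mul_smul_comm, ← mul_assoc,
      smul_mul_assoc, mul_assoc, hAA, mul_one, ← pow_add, ← two_mul, hP, shiftMatrix_pow_self, hi,
      smul_smul, smul_smul, mul_assoc, mul_comm _ lam, hlamk]
    simp
  · rw [transpose_smul, transpose_mul, hP, shiftMatrix_pow_half_transpose hlam2, ← hP, hA,
      alternatingMatrix, diagonal_transpose, ← alternatingMatrix, ← hA, mul_smul_comm, hAPk,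
      smul_smul lam, hlamk]
    simp
  · have h1 : (θ : K →+* K).mapMatrix (i • (P ^ k * A)) = -(i • (P ^ k * A)) := by
      rw [smul_eq_diagonal_mul, map_mul, map_mul, map_pow, hP, mapMatrix_shiftMatrix, hA,
        alternatingMatrix]
      simp [diagonal_map, hθ, hlam, ← diagonal_neg]
    rw [h1, mul_neg, smul_mul_assoc, mul_assoc, hAP, mul_smul_comm, mul_neg, ← mul_assoc,
      ← mul_assoc, ← hP, ← pow_succ, ← pow_succ', smul_neg]

theorem exists_selfDual_of_two_pow_dvd {p : ℕ} [Fact p.Prime] [CharP K p] (h2 : (2 : K) ≠ 0)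
    (θ : K ≃+* K) {μ c l : ℕ} (hμ : 2 ≤ μ) (hc : Odd c) (hp : p + 1 = 2 ^ μ * c)
    [NeZero (2 ^ μ * l)] :
    ∃ D : Submodule K (Fin (2 ^ μ * l) → K), IsSelfDual D ∧ IsShiftStable θ (-1) D := by
  set P := shiftMatrix (2 ^ μ * l) (-1 : K) with hP
  set N := P ^ l with hN
  have hNN : Nᵀ * N = 1 := shiftMatrix_pow_transpose_mul_self (by simp) l
  have hNN' : N * Nᵀ = 1 := mul_eq_one_comm.1 hNN
  have hNpow : N ^ 2 ^ μ = -1 := by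
    have h : P ^ (2 ^ μ * l) = (-1 : K) • 1 := shiftMatrix_pow_self (-1)
    rw [hN, pow_right_comm, ← pow_mul, h]
    simp
  -- `N ^ (p + 1) = (-1) ^ c = -1` and `Nᵀ` is the inverse of `N`; hence Frobenius will fix `N -
  -- Nᵀ`.
  have hNp : N ^ p = -Nᵀ := by
    have h : N ^ p * N = -1 := by
      rw [← pow_succ, hp, pow_mul, hNpow, hc.neg_one_pow]
    calc N ^ p = N ^ p * N * Nᵀ := by rw [mul_assoc, hNN', mul_one]
      _ = -Nᵀ := by rw [h]; simp
  have hNtp : Nᵀ ^ p = -N := by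
    rw [← transpose_pow, hNp]
    simp
  set d := N - Nᵀ with hd
  have hdt : dᵀ = -d := by simp [hd]
  have hdp : d ^ p = d := by
    rw [hd, sub_pow_char_of_commute p (hNN'.trans hNN.symm), hNp, hNtp]
    abel
  -- `d N = N ^ 2 - 1` divides `N ^ 2 ^ μ - 1 = -2` through a geometric sum.
  have hdu : IsUnit d := by
    have h1 : d * N = N ^ 2 - 1 := by rw [hd, sub_mul, hNN, pow_two]
    have h3 : (N ^ 2 - 1) * ∑ j ∈ Finset.range (2 ^ (μ - 1)), (N ^ 2) ^ j = -2 := by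
      rw [mul_geom_sum, ← pow_mul, ← pow_succ', Nat.sub_add_cancel (by lia), hNpow]
      norm_num
    have h4 : d * ((-2⁻¹ : K) • (N * ∑ j ∈ Finset.range (2 ^ (μ - 1)), (N ^ 2) ^ j)) = 1 := by
      have h5 : (-2 : Matrix (Fin (2 ^ μ * l)) (Fin (2 ^ μ * l)) K) = (-2 : K) • 1 := by
        rw [neg_smul, two_smul, one_add_one_eq_two]
      rw [mul_smul_comm, ← mul_assoc, h1, h3, h5, smul_smul, neg_mul_neg, inv_mul_cancel₀ h2,
        one_smul]
    exact IsUnit.of_mul_eq_one _ h4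
  -- `m` is odd because `4 ∣ p + 1`; this makes `d ^ m` skew-symmetric, while `d ^ (p - 1) = 1`
  -- makes it an involution.
  obtain ⟨m, hm⟩ : ∃ m, p = 2 * m + 1 ∧ Odd m := by
    obtain ⟨ν, rfl⟩ := Nat.exists_eq_add_of_le hμ
    refine ⟨2 * (2 ^ ν * c) - 1, ?_, ?_⟩
    · have : 0 < 2 ^ ν * c := by have := hc.pos; positivity
      rw [pow_add] at hp
      lia
    · have : 0 < 2 ^ ν * c := by have := hc.pos; positivity
      exact ⟨2 ^ ν * c - 1, by lia⟩
  have hd1 : d ^ (2 * m) = 1 := by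
    rw [hm.1, pow_succ] at hdp
    exact hdu.mul_eq_right.1 hdp
  have hPN : Commute P N := Commute.pow_right rfl l
  have hPNt : Commute P Nᵀ := by
    calc P * Nᵀ = Nᵀ * N * P * Nᵀ := by rw [hNN, one_mul]
      _ = Nᵀ * (P * N) * Nᵀ := by rw [hPN.eq, mul_assoc Nᵀ]
      _ = Nᵀ * P := by rw [← mul_assoc, mul_assoc, hNN', mul_one]
  have hPd : Commute P (d ^ m) := (hPN.sub_right hPNt).pow_right m
  refine exists_selfDual_of_skew_involution h2 θ (-1) (d ^ m) ?_ ?_ ?_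
  · rw [← pow_add, ← two_mul, hd1]
  · rw [transpose_pow, hdt, hm.2.neg_pow]
  · have h1 : (θ : K →+* K).mapMatrix (d ^ m) = d ^ m := by
      -- The entries of the shift matrix are `0` and `±1`, so `θ` fixes them.
      have h3 : (θ : K →+* K).mapMatrix N = N := by
        rw [hN, map_pow, hP, mapMatrix_shiftMatrix]
        simp
      have h4 : (θ : K →+* K).mapMatrix Nᵀ = Nᵀ := by
        conv_rhs => rw [← h3]
        rfl
      rw [map_pow, hd, map_sub, h3, h4]
    rw [h1]
    exact hPd

end Projector

/-! ### Extension of scalars of a code. -/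

section BaseChange

variable {F K : Type*} [Field F] [Field K] [Algebra F K] {n : ℕ}

/-- The extension of scalars of a linear code `C ⊆ Fⁿ` to a field extension `K` of `F`. -/
def baseChangeCode (K : Type*) [Field K] [Algebra F K] (C : Submodule F (Fin n → F)) :
    Submodule K (Fin n → K) where
  carrier := {v | ∀ f : K →ₗ[F] F, (fun i => f (v i)) ∈ C}
  zero_mem' := fun f => by
    convert C.zero_mem using 1
    funext i
    simp
  add_mem' := fun {a b} ha hb f => by
    convert C.add_mem (ha f) (hb f) using 1
    funext i
    simp
  smul_mem' := fun c a ha f => ha (f ∘ₗ LinearMap.mulLeft F c)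

theorem mem_baseChangeCode {C : Submodule F (Fin n → F)} {v : Fin n → K} :
    v ∈ baseChangeCode K C ↔ ∀ f : K →ₗ[F] F, (fun i => f (v i)) ∈ C := Iff.rfl

theorem algebraMap_mem_baseChangeCode {C : Submodule F (Fin n → F)} {c : Fin n → F} (hc : c ∈ C) :
    (fun i => algebraMap F K (c i)) ∈ baseChangeCode K C := fun f => by
  convert C.smul_mem (f 1) hc using 1
  funext i
  change f (algebraMap F K (c i)) = _
  rw [Algebra.algebraMap_eq_smul_one, map_smul, Pi.smul_apply, smul_eq_mul, smul_eq_mul, mul_comm]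

theorem map_algebraMap_dotProduct (f : K →ₗ[F] F) (c : Fin n → F) (v : Fin n → K) :
    f ((fun i => algebraMap F K (c i)) ⬝ᵥ v) = c ⬝ᵥ fun i => f (v i) := by
  simp [dotProduct, ← Algebra.smul_def]

theorem isSelfDual_baseChangeCode [FiniteDimensional F K] {C : Submodule F (Fin n → F)}
    (hC : IsSelfDual C) : IsSelfDual (baseChangeCode K C) := by
  ext w
  constructor
  · intro hw f
    rw [← hC]
    intro c hc
    rw [dotProduct_comm, ← map_algebraMap_dotProduct, dotProduct_comm,
      hw _ (algebraMap_mem_baseChangeCode hc), map_zero]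
  · intro hw v hv
    let b := Module.finBasis F K
    have h1 : w ⬝ᵥ v = ∑ s, b s * ((fun i => algebraMap F K (b.coord s (w i))) ⬝ᵥ v) := by
      simp only [dotProduct, Finset.mul_sum]
      rw [Finset.sum_comm]
      refine Finset.sum_congr rfl fun i _ => ?_
      conv_lhs => rw [← b.sum_repr (w i)]
      rw [Finset.sum_mul]
      refine Finset.sum_congr rfl fun s _ => ?_
      rw [Algebra.smul_def, Module.Basis.coord_apply]
      ring
    have h2 : ∀ s, (fun i => algebraMap F K (b.coord s (w i))) ⬝ᵥ v = 0 := by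
      intro s
      refine b.ext_elem fun t => ?_
      have h3 := hw (b.coord s)
      rw [← hC] at h3
      have h4 := map_algebraMap_dotProduct (b.coord t) (fun i => b.coord s (w i)) v
      rw [h3 _ (hv (b.coord t))] at h4
      simpa using h4
    rw [h1]
    exact Finset.sum_eq_zero fun s _ => by rw [h2, mul_zero]

theorem mulVec_mem_baseChangeCode {C : Submodule F (Fin n → F)} {A : Matrix (Fin n) (Fin n) F}
    (hA : ∀ c ∈ C, A *ᵥ c ∈ C) {v : Fin n → K} (hv : v ∈ baseChangeCode K C) :
    (algebraMap F K).mapMatrix A *ᵥ v ∈ baseChangeCode K C := fun f => by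
  convert hA _ (hv f) using 1
  funext i
  exact map_algebraMap_dotProduct f (A i) v

theorem algHom_mem_baseChangeCode {C : Submodule F (Fin n → F)} (σ : K →ₐ[F] K) {v : Fin n → K}
    (hv : v ∈ baseChangeCode K C) : (fun i => σ (v i)) ∈ baseChangeCode K C :=
  fun f => hv (f ∘ₗ σ.toLinearMap)

end BaseChange

/-! ### Eigenvectors of the `k`-th power of the shift. -/

section Eigenvectors

variable {K : Type*} [Field K] {m k : ℕ}

/-- The vector with entries `z⁻ⁱ w_j` at the index `j + k i`, an eigenvector of the `k`-th power
of the shift matrix if `z ^ m = lam`. -/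
def spread (m : ℕ) (z : K) : (Fin k → K) →ₗ[K] (Fin (m * k) → K) where
  toFun w l := z⁻¹ ^ (l / k : ℕ) * w l.modNat
  map_add' w w' := by
    funext l
    simp [mul_add]
  map_smul' c w := by
    funext l
    simp [mul_left_comm]

theorem spread_apply (z : K) (w : Fin k → K) (l : Fin (m * k)) :
    spread m z w l = z⁻¹ ^ (l / k : ℕ) * w l.modNat := rfl

theorem spread_dotProduct_spread_inv {z : K} (hz : z ≠ 0) (w w' : Fin k → K) :
    spread m z w ⬝ᵥ spread m z⁻¹ w' = m * (w ⬝ᵥ w') := by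
  have h : ∀ l : Fin (m * k), spread m z w l * spread m z⁻¹ w' l = w l.modNat * w' l.modNat := by
    intro l
    have h1 : z⁻¹ ^ (l / k : ℕ) * z ^ (l / k : ℕ) = 1 := by
      rw [← mul_pow, inv_mul_cancel₀ hz, one_pow]
    rw [spread_apply, spread_apply, inv_inv]
    linear_combination (w l.modNat * w' l.modNat) * h1
  rw [dotProduct, Finset.sum_congr rfl fun l _ => h l, ← finProdFinEquiv.sum_comp,
    Fintype.sum_prod_type]
  have h2 : ∀ x : Fin m × Fin k, (finProdFinEquiv x).modNat = x.2 := fun x =>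
    congrArg Prod.snd (finProdFinEquiv.symm_apply_apply x)
  simp [h2, dotProduct]

variable [NeZero (m * k)]

theorem shiftMatrix_pow_mulVec_spread {z lam : K} (hlam : lam * lam = 1) (hz : z ^ m = lam)
    (w : Fin k → K) :
    shiftMatrix (m * k) lam ^ k *ᵥ spread m z w = z • spread m z w := by
  have hmk : m * k ≠ 0 := NeZero.ne _
  have hm : 0 < m := by grind
  have hk : 0 < k := by grind
  have hlam0 : lam ≠ 0 := left_ne_zero_of_mul_eq_one hlam
  have hz0 : z ≠ 0 := by
    rintro rfl
    rw [zero_pow hm.ne'] at hz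
    exact hlam0 hz.symm
  have hle : k ≤ m * k := Nat.le_mul_of_pos_left k hm
  obtain ⟨h1, h2⟩ := shiftMatrix_pow_mulVec lam (spread m z w) k hle
  funext j
  rw [Pi.smul_apply, smul_eq_mul]
  have hj := j.2
  by_cases hjk : k ≤ j
  · let l : Fin (m * k) := ⟨j - k, by lia⟩
    have hl : (l : ℕ) + k = j := Nat.sub_add_cancel hjk
    have hmod : j.modNat = l.modNat := Fin.ext (by
      rw [Fin.coe_modNat, Fin.coe_modNat, ← hl, Nat.add_mod_right])
    rw [h1 j l hl, spread_apply, spread_apply, hmod, ← hl, Nat.add_div_right _ hk, pow_succ]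
    field_simp
  · let l : Fin (m * k) := ⟨j + m * k - k, by lia⟩
    have hl : (l : ℕ) = j + k * (m - 1) := by
      have : m * k = k * (m - 1) + k := by
        obtain ⟨m', rfl⟩ := Nat.exists_eq_succ_of_ne_zero hm.ne'
        simp
        ring
      simp only [l]
      lia
    have hmod : j.modNat = l.modNat := Fin.ext (by
      rw [Fin.coe_modNat, Fin.coe_modNat, hl, Nat.add_mul_mod_self_left])
    rw [h2 j l (by simp only [l]; lia), spread_apply, spread_apply, hmod, hl,
      Nat.add_mul_div_left _ _ hk, Nat.div_eq_of_lt (not_le.1 hjk), zero_add, pow_zero, one_mul,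
      ← mul_assoc]
    congr 1
    have h3 : z ^ (m - 1) * z = lam := by rw [← pow_succ, Nat.sub_add_cancel hm, hz]
    rw [inv_pow, ← div_eq_mul_inv, div_eq_iff (pow_ne_zero _ hz0), mul_comm z, h3]

/-- The eigenvalue equation expresses each entry through the one `k` places earlier, so the first
`k` entries determine the vector. -/
theorem eq_spread_of_eigenvector {z lam : K} (hz : z ≠ 0) {y : Fin (m * k) → K}
    (hy : shiftMatrix (m * k) lam ^ k *ᵥ y = z • y) : ∃ w, y = spread m z w := by
  have hmk : m * k ≠ 0 := NeZero.ne _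
  have hm : 0 < m := by grind
  have hk : 0 < k := by grind
  have hle : k ≤ m * k := Nat.le_mul_of_pos_left k hm
  have h1 := (shiftMatrix_pow_mulVec lam y k hle).1
  refine ⟨fun j => y (j.castLE hle), ?_⟩
  suffices h : ∀ (N : ℕ) (j : Fin (m * k)), (j : ℕ) = N →
      y j = z⁻¹ ^ (j / k : ℕ) * y (j.modNat.castLE hle) from funext fun j => h _ j rfl
  intro N
  induction N using Nat.strong_induction_on with
  | _ N ih =>
    rintro j rfl
    have hj := j.2
    by_cases hjk : k ≤ j
    · let l : Fin (m * k) := ⟨j - k, by lia⟩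
      have hl : (l : ℕ) + k = j := Nat.sub_add_cancel hjk
      have hmod : j.modNat = l.modNat := Fin.ext (by
        rw [Fin.coe_modNat, Fin.coe_modNat, ← hl, Nat.add_mod_right])
      have h3 := h1 j l hl
      rw [hy, Pi.smul_apply, smul_eq_mul, ih l (by lia) l rfl] at h3
      rw [hmod, ← hl, Nat.add_div_right _ hk, pow_succ', mul_assoc, ← h3, inv_mul_cancel_left₀ hz]
    · have hmod : j.modNat.castLE hle = j := Fin.ext (by
        rw [Fin.val_castLE, Fin.coe_modNat, Nat.mod_eq_of_lt (not_le.1 hjk)])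
      rw [hmod, Nat.div_eq_of_lt (not_le.1 hjk), pow_zero, one_mul]

end Eigenvectors

/-! ### The parity obstruction from Frobenius and duality. -/

section Obstruction

variable {F K : Type*} [Field F] [Field K] [Algebra F K] {m k : ℕ}

/-- The `q`-Frobenius preserves the extended code and sends `z` to `z⁻¹`. It is only semilinear over
`K`, so the dimensions are compared by counting elements. -/
theorem finrank_comap_spread_le [Finite F] [FiniteDimensional F K] {C : Submodule F (Fin (m * k) → F)} {z : K}
    (hz : z ^ Nat.card F = z⁻¹) :
    Module.finrank K ((baseChangeCode K C).comap (spread m z)) ≤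
      Module.finrank K ((baseChangeCode K C).comap (spread m z⁻¹)) := by
  have : Finite K := Module.finite_of_finite F
  cases nonempty_fintype F
  let σ := FiniteField.frobeniusAlgHom F K
  have hσz : σ z = z⁻¹ := by
    rw [← hz, Nat.card_eq_fintype_card]
    rfl
  have h : ∀ w ∈ (baseChangeCode K C).comap (spread m z),
      (fun j => σ (w j)) ∈ (baseChangeCode K C).comap (spread m z⁻¹) := by
    intro w hw
    rw [Submodule.mem_comap] at hw ⊢
    convert algHom_mem_baseChangeCode σ hw using 1
    funext l
    simp [spread_apply, hσz]
  have hinj : Function.Injective fun w : (baseChangeCode K C).comap (spread m z) =>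
      (⟨_, h w.1 w.2⟩ : (baseChangeCode K C).comap (spread m z⁻¹)) := by
    intro w w' hww
    refine Subtype.ext (funext fun j => σ.injective ?_)
    exact congrFun (congrArg Subtype.val hww) j
  have hcard := Nat.card_le_card_of_injective _ hinj
  rw [Module.natCard_eq_pow_finrank (K := K) (V := (baseChangeCode K C).comap (spread m z)),
    Module.natCard_eq_pow_finrank (K := K) (V := (baseChangeCode K C).comap (spread m z⁻¹))] at hcard
  exact (Nat.pow_le_pow_iff_right Finite.one_lt_card).1 hcard

variable [NeZero (m * k)]

theorem dualCode_comap_spread {D : Submodule K (Fin (m * k) → K)} (hD : IsSelfDual D) {z lam : K}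
    (hlam : lam * lam = 1) (hz : z ^ m = lam) (hm : (m : K) ≠ 0)
    (hstab : ∀ v ∈ D, shiftMatrix (m * k) lam ^ k *ᵥ v ∈ D) :
    dualCode (D.comap (spread m z⁻¹)) = D.comap (spread m z) := by
  have hm0 : m ≠ 0 := fun h => hm (by simp [h])
  have hz0 : z ≠ 0 := by
    rintro rfl
    rw [zero_pow hm0] at hz
    simp [← hz] at hlam
  set M := shiftMatrix (m * k) lam ^ k with hM
  have hMt : Mᵀ * M = 1 := shiftMatrix_pow_transpose_mul_self hlam k
  have hMm : M ^ m = lam • 1 := by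
    have h : shiftMatrix (m * k) lam ^ (m * k) = lam • 1 := shiftMatrix_pow_self lam
    rw [hM, pow_right_comm, ← pow_mul, h]
  ext w
  constructor
  · intro hw
    rw [Submodule.mem_comap, ← hD]
    intro c hc
    set v := spread m z w with hv
    have hMv : M *ᵥ v = z • v := shiftMatrix_pow_mulVec_spread hlam hz w
    have hpow : ∀ d : ℕ, z ^ d * (v ⬝ᵥ (M ^ d *ᵥ c)) = v ⬝ᵥ c := by
      intro d
      induction d with
      | zero => simp
      | succ d ih =>
        have h1 : (M *ᵥ v) ⬝ᵥ (M *ᵥ (M ^ d *ᵥ c)) = v ⬝ᵥ (M ^ d *ᵥ c) := by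
          rw [dotProduct_mulVec, ← mulVec_transpose, mulVec_mulVec, hMt, one_mulVec]
        rw [hMv, mulVec_mulVec, ← pow_succ', smul_dotProduct, smul_eq_mul] at h1
        rw [pow_succ, mul_assoc, h1, ih]
    -- Up to the factor `m`, this projects `c` onto the `z⁻¹`-eigenspace of `M`; as `M` is
    -- orthogonal, each summand pairs with `v` as `c` does.
    set y := ∑ d ∈ Finset.range m, z ^ d • (M ^ d *ᵥ c) with hy
    have hyD : y ∈ D := by
      refine D.sum_mem fun d hd => D.smul_mem _ ?_
      clear hd
      induction d with
      | zero => simpa using hc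
      | succ d ih =>
        rw [pow_succ', ← mulVec_mulVec]
        exact hstab _ ih
    have hyM : M *ᵥ y = z⁻¹ • y := by
      have h1 : z • (M *ᵥ y) = ∑ d ∈ Finset.range m, z ^ (d + 1) • (M ^ (d + 1) *ᵥ c) := by
        rw [hy, mulVec_sum, Finset.smul_sum]
        refine Finset.sum_congr rfl fun d _ => ?_
        rw [mulVec_smul, mulVec_mulVec, smul_smul, ← pow_succ', ← pow_succ']
      have h2 : z • (M *ᵥ y) = y := by
        have h3 := Finset.sum_range_succ (fun d => z ^ d • (M ^ d *ᵥ c)) m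
        rw [Finset.sum_range_succ', ← h1, ← hy, hz, hMm, smul_mulVec, smul_smul, hlam] at h3
        simpa using h3
      rw [← h2, smul_smul, inv_mul_cancel₀ hz0, one_smul, h2]
    obtain ⟨w', hw'⟩ := eq_spread_of_eigenvector (inv_ne_zero hz0) hyM
    have h1 : v ⬝ᵥ y = m * (v ⬝ᵥ c) := by
      rw [hy, dotProduct_sum, Finset.sum_congr rfl fun d _ => (dotProduct_smul _ _ _).trans (hpow d)]
      simp
    rw [hw', hv, spread_dotProduct_spread_inv hz0, hw w' (by rwa [Submodule.mem_comap, ← hw']),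
      ← hv, mul_zero] at h1
    exact (mul_eq_zero.1 h1.symm).resolve_left hm
  · intro hw w' hw'
    rw [Submodule.mem_comap, ← hD] at hw
    have h1 := hw _ hw'
    rw [spread_dotProduct_spread_inv hz0] at h1
    exact (mul_eq_zero.1 h1).resolve_left hm

/-- The preimages of the extended code under `spread m z` and `spread m z⁻¹` are dual in `K ^ k` and
have equal dimension, so `k` would be even. -/
theorem not_isSelfDual_of_odd [Finite F] [FiniteDimensional F K] {C : Submodule F (Fin (m * k) → F)} {lam : F}
    (hlam : lam * lam = 1) {z : K} (hz : z ^ m = algebraMap F K lam)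
    (hzq : z ^ Nat.card F = z⁻¹) (hm : (m : K) ≠ 0) (hk : Odd k)
    (hstab : ∀ v ∈ C, shiftMatrix (m * k) lam ^ k *ᵥ v ∈ C) : ¬ IsSelfDual C := by
  intro hC
  have h1 := finrank_comap_spread_le (m := m) (C := C) hzq
  have h2 := finrank_comap_spread_le (m := m) (C := C) (z := z⁻¹) (by rw [inv_pow, hzq])
  rw [inv_inv] at h2
  have h3 := dualCode_comap_spread (isSelfDual_baseChangeCode (K := K) hC)
    (by rw [← map_mul, hlam, map_one]) hz hm fun v hv => by
      have := mulVec_mem_baseChangeCode hstab hv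
      rwa [map_pow, mapMatrix_shiftMatrix] at this
  have h4 := finrank_add_finrank_dualCode ((baseChangeCode K C).comap (spread m z⁻¹))
  rw [h3] at h4
  obtain ⟨t, rfl⟩ := hk
  lia

end Obstruction

theorem det_shiftMatrix {R : Type*} [CommRing R] {n : ℕ} [NeZero n] (lam : R) :
    (shiftMatrix n lam).det = lam * (-1) ^ (n - 1) := by
  obtain ⟨m, rfl⟩ := Nat.exists_eq_succ_of_ne_zero (NeZero.ne n)
  have h : shiftMatrix (m + 1) lam =
      diagonal (fun j => if j = 0 then lam else 1) *
        ((finRotate (m + 1))⁻¹ : Equiv.Perm (Fin (m + 1))).permMatrix R := by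
    ext j l
    rw [diagonal_mul, Equiv.Perm.permMatrix, PEquiv.toMatrix_apply]
    have h1 : (finRotate (m + 1))⁻¹ j = j - 1 := by
      rw [Equiv.Perm.inv_eq_iff_eq]
      simp
    simp [shiftMatrix, h1, eq_comm]
  rw [h, det_mul, det_diagonal, det_permutation, Equiv.Perm.sign_inv, sign_finRotate]
  simp

/-! ### The determinant obstruction. -/

section GraphForm

variable {K : Type*} [Field K] {k : ℕ}

/-- A self-dual code of length `2 k` is, after a splitting of the coordinates into two halves, the
graph of a linear map. -/
theorem exists_graph_of_isSelfDual {C : Submodule K (Fin (2 * k) → K)} (hC : IsSelfDual C) :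
    ∃ (e : Fin k ⊕ Fin k ≃ Fin (2 * k)) (B : Matrix (Fin k) (Fin k) K),
      ∀ v : Fin (2 * k) → K, v ∈ C ↔ ∃ x, v ∘ e = fromRows B 1 *ᵥ x := by
  have hdim : Module.finrank K C = k := by
    have := hC.two_mul_finrank
    lia
  let φ : Fin (2 * k) → Module.Dual K C := fun j => LinearMap.proj j ∘ₗ C.subtype
  -- The coordinate functionals span the dual of `C`; a basis among them gives an information set of
  -- `k` positions.
  obtain ⟨κ, a, ha, hspan, hli⟩ := exists_linearIndependent' K φ
  have : Finite κ := Finite.of_injective a ha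
  cases nonempty_fintype κ
  have hzero : ∀ v : C, (∀ i, v.1 (a i) = 0) → v = 0 := by
    intro v hv
    refine Subtype.ext (funext fun j => ?_)
    have hj : φ j ∈ Submodule.span K (Set.range (φ ∘ a)) :=
      hspan ▸ Submodule.subset_span ⟨j, rfl⟩
    have hle : Submodule.span K (Set.range (φ ∘ a)) ≤
        LinearMap.ker (Module.Dual.eval K C v) := by
      rw [Submodule.span_le]
      rintro _ ⟨i, rfl⟩
      exact hv i
    exact hle hj
  have hκ : Fintype.card κ = k := by
    apply le_antisymm
    · have := hli.fintype_card_le_finrank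
      rwa [Subspace.dual_finrank_eq, hdim] at this
    · let f : C →ₗ[K] (κ → K) := LinearMap.pi fun i => φ (a i)
      have hf : Function.Injective f := (injective_iff_map_eq_zero f).2 fun v hv =>
        hzero v fun i => congrFun hv i
      have := LinearMap.finrank_le_finrank_of_injective hf
      rwa [hdim, Module.finrank_fintype_fun_eq_card] at this
  have hc1 : Nat.card (Set.range a) = k := by
    rw [Nat.card_range_of_injective ha, Nat.card_eq_fintype_card, hκ]
  have hc2 : Nat.card ((Set.range a)ᶜ : Set (Fin (2 * k))) = k := by
    have h := Nat.card_congr (Equiv.Set.sumCompl (Set.range a))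
    rw [Nat.card_sum, hc1, Nat.card_fin] at h
    lia
  let f1 : Fin k ≃ Set.range a := (Finite.equivFinOfCardEq hc1).symm
  let f2 : Fin k ≃ ((Set.range a)ᶜ : Set (Fin (2 * k))) := (Finite.equivFinOfCardEq hc2).symm
  let e : Fin k ⊕ Fin k ≃ Fin (2 * k) := (Equiv.sumComm _ _).trans
    ((Equiv.sumCongr f1 f2).trans (Equiv.Set.sumCompl (Set.range a)))
  have he : ∀ x, e (Sum.inr x) = f1 x := fun x => rfl
  let f : C →ₗ[K] (Fin k → K) := LinearMap.pi fun x => φ (e (Sum.inr x))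
  have hf : Function.Injective f := (injective_iff_map_eq_zero f).2 fun v hv =>
    hzero v fun i => by
      have h := congrFun hv (f1.symm ⟨a i, i, rfl⟩)
      change v.1 (e (Sum.inr _)) = 0 at h
      rwa [he, Equiv.apply_symm_apply] at h
  let E : C ≃ₗ[K] (Fin k → K) := LinearEquiv.ofInjectiveOfFinrankEq f hf (by simp [hdim])
  have hE : ∀ (v : C) x, E v x = v.1 (e (Sum.inr x)) := fun v x => rfl
  let g : (Fin k → K) →ₗ[K] (Fin k → K) :=
    LinearMap.pi fun x => φ (e (Sum.inl x)) ∘ₗ E.symm.toLinearMap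
  have hg : ∀ v : C, v.1 ∘ e = fromRows (LinearMap.toMatrix' g) 1 *ᵥ E v := by
    intro v
    rw [fromRows_mulVec, LinearMap.toMatrix'_mulVec, one_mulVec]
    funext x
    rcases x with x | x
    · change _ = (E.symm (E v)).1 (e (Sum.inl x))
      rw [E.symm_apply_apply]
      rfl
    · exact (hE v x).symm
  refine ⟨e, LinearMap.toMatrix' g, fun v => ⟨fun hv => ⟨E ⟨v, hv⟩, hg ⟨v, hv⟩⟩, ?_⟩⟩
  rintro ⟨x, hx⟩
  have h := hg (E.symm x)
  rw [E.apply_symm_apply, ← hx] at h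
  have h' : (E.symm x).1 = v := by
    funext j
    simpa using congrFun h (e.symm j)
  exact h' ▸ (E.symm x).2

/-- An isometry matrix `P` that maps the conjugate of the graph of `B` to the graph of `B`
satisfies `det P * θ (det B) = det B`, if the graph is totally isotropic. -/
theorem det_mul_map_det_of_graph (θ : K →+* K) {P : Matrix (Fin k ⊕ Fin k) (Fin k ⊕ Fin k) K}
    (hP : Pᵀ * P = 1) {B U : Matrix (Fin k) (Fin k) K} (hB : Bᵀ * B = -1)
    (h : P * (fromRows B 1).map θ = fromRows B 1 * U) : P.det * θ B.det = B.det := by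
  set G := fromRows B (1 : Matrix (Fin k) (Fin k) K) with hG
  set H := fromRows (0 : Matrix (Fin k) (Fin k) K) (1 : Matrix (Fin k) (Fin k) K) with hH
  set X := -(Bᵀ * (P * H).toRows₁) with hX
  set Y := (P * H).toRows₂ - X with hY
  have hB' : B * Bᵀ = -1 := by
    have h1 : (-Bᵀ) * B = 1 := by rw [neg_mul, hB, neg_neg]
    have h2 := mul_eq_one_comm.1 h1
    rwa [mul_neg, neg_eq_iff_eq_neg] at h2
  have hGG : Gᵀ * G = 0 := by
    rw [hG, transpose_fromRows, fromCols_mul_fromRows, hB]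
    simp
  have hGH : Gᵀ * H = 1 := by
    rw [hG, hH, transpose_fromRows, fromCols_mul_fromRows]
    simp
  have hGHθ : (G.map θ)ᵀ * H = 1 := by
    have h1 : (G.map θ)ᵀ * H = (Gᵀ * H).map θ := by
      rw [Matrix.map_mul]
      congr 1
      ext i j
      rcases i with i | i <;> simp [hH, one_apply, apply_ite θ]
    rw [h1, hGH]
    simp [Matrix.map_one]
  have hPH : P * H = G * X + H * Y := by
    rw [← fromRows_toRows (P * H), hG, hH, fromRows_mul, fromRows_mul, hX, mul_neg, ← mul_assoc,
      hB']
    ext i j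
    rcases i with i | i <;> simp [hY, hX, ← hH]
  have hGU : P * G.map θ = G * U := h
  -- `P` preserves the pairing of the isotropic `G` with its complement `H`, so the diagonal blocks
  -- `U` and `Y` have inverse determinants.
  have hUY : Uᵀ * Y = 1 := by
    have h1 : (P * G.map θ)ᵀ * (P * H) = 1 := by
      rw [transpose_mul, Matrix.mul_assoc, ← Matrix.mul_assoc Pᵀ, hP, Matrix.one_mul, hGHθ]
    rw [hGU, hPH, transpose_mul, Matrix.mul_add, Matrix.mul_assoc, Matrix.mul_assoc,
      ← Matrix.mul_assoc Gᵀ, ← Matrix.mul_assoc Gᵀ, hGG, hGH] at h1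
    simpa using h1
  set W := fromBlocks B 0 1 (1 : Matrix (Fin k) (Fin k) K) with hW
  have hWG : W = fromCols G H := by
    rw [hW, hG, hH, fromCols_fromRows_eq_fromBlocks]
  have hWθ : θ.mapMatrix W = fromCols (G.map θ) H := by
    rw [hWG]
    ext i j
    rcases i with i | i <;> rcases j with j | j <;> simp [hH, hG, one_apply, apply_ite θ]
  have key : P * θ.mapMatrix W = W * fromBlocks U X 0 Y := by
    rw [hWθ, mul_fromCols, hGU, hPH, hWG, ← fromCols_fromRows_eq_fromBlocks, mul_fromCols,
      fromCols_mul_fromRows, fromCols_mul_fromRows]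
    simp
  have hdetW : W.det = B.det := by
    rw [hW, det_fromBlocks_zero₁₂, det_one, mul_one]
  have hdet := congrArg det key
  have hUYdet := congrArg det hUY
  rw [det_mul, det_transpose, det_one] at hUYdet
  rwa [det_mul, det_mul, det_fromBlocks_zero₂₁, hUYdet, mul_one, ← RingHom.map_det, hdetW] at hdet

end GraphForm

theorem IsSelfDual.exists_sq_eq_of_isShiftStable {K : Type*} [Field K] {k : ℕ} [NeZero (2 * k)]
    {θ : K ≃+* K} {lam : K} (hlam : lam * lam = 1) {C : Submodule K (Fin (2 * k) → K)}
    (hC : IsSelfDual C) (hs : IsShiftStable θ lam C) :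
    ∃ d : K, d ^ 2 = (-1) ^ k ∧ -lam * θ d = d := by
  obtain ⟨e, B, hB⟩ := exists_graph_of_isSelfDual hC
  set G := fromRows B (1 : Matrix (Fin k) (Fin k) K) with hG
  have hmem : ∀ x, (G *ᵥ x) ∘ e.symm ∈ C := fun x =>
    (hB _).2 ⟨x, by rw [Function.comp_assoc, e.symm_comp_self, Function.comp_id]⟩
  have hGG : Gᵀ * G = 0 := by
    refine Matrix.ext_iff_mulVec.2 fun x => dotProduct_eq _ _ fun y => ?_
    have h1 := hmem x
    rw [← hC] at h1
    have h2 := h1 _ (hmem y)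
    rw [comp_equiv_symm_dotProduct, Function.comp_assoc, e.symm_comp_self, Function.comp_id] at h2
    rw [← mulVec_mulVec, mulVec_transpose, ← dotProduct_mulVec, h2]
    simp
  have hBB : Bᵀ * B = -1 := by
    rw [hG, transpose_fromRows, fromCols_mul_fromRows] at hGG
    rw [eq_neg_iff_add_eq_zero]
    simpa using hGG
  set P := (shiftMatrix (2 * k) lam).submatrix e e with hP
  have hPP : Pᵀ * P = 1 := by
    rw [hP, transpose_submatrix, submatrix_mul_equiv, shiftMatrix_transpose_mul_self hlam,
      submatrix_one_equiv]
  have hshift : ∀ y, ∃ z, (P * G.map θ) *ᵥ y = G *ᵥ z := by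
    intro y
    obtain ⟨x, rfl⟩ : ∃ x, θ ∘ x = y := ⟨θ.symm ∘ y, by
      funext i
      simp⟩
    obtain ⟨z, hz⟩ := (hB _).1 (hs _ (hmem x))
    refine ⟨z, ?_⟩
    have h1 : θ ∘ (G *ᵥ x) = G.map θ *ᵥ (θ ∘ x) := by
      funext i
      exact RingHom.map_mulVec (θ : K →+* K) G x i
    rw [← hz, constaShift_eq, ← mulVec_mulVec, ← h1, hP, submatrix_mulVec_equiv]
    rfl
  have hU : P * G.map θ = G * (P * G.map θ).toRows₂ := by
    refine Matrix.ext_iff_mulVec.2 fun y => ?_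
    obtain ⟨z, hz⟩ := hshift y
    have h1 : (P * G.map θ).toRows₂ *ᵥ y = z := by
      have h2 : (P * G.map θ).toRows₂ *ᵥ y = ((P * G.map θ) *ᵥ y) ∘ Sum.inr := rfl
      rw [h2, hz, hG, fromRows_mulVec, one_mulVec]
      rfl
    rw [hz, ← h1, mulVec_mulVec]
  refine ⟨B.det, ?_, ?_⟩
  · have h1 := congrArg det hBB
    rw [det_mul, det_transpose, det_neg, det_one] at h1
    rw [pow_two, h1]
    simp
  · have h1 := det_mul_map_det_of_graph (θ : K →+* K) hPP hBB hU
    have hodd : (-1 : K) ^ (2 * k - 1) = -1 := by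
      have : 2 * k ≠ 0 := NeZero.ne _
      exact Odd.neg_one_pow (by grind)
    rw [hP, det_submatrix_equiv_self, det_shiftMatrix, hodd] at h1
    simpa using h1

/-- `θ` lies in the Galois group over the prime field, which has order `r`. -/
theorem iterate_eq_self_of_card {F : Type*} [Field F] [Finite F] {p r : ℕ} [Fact p.Prime]
    [CharP F p] (hq : Nat.card F = p ^ r) (θ : F ≃+* F) (x : F) : θ^[r] x = x := by
  let _ : Algebra (ZMod p) F := ZMod.algebra F p
  have hr : Module.finrank (ZMod p) F = r := by
    have h := Module.natCard_eq_pow_finrank (K := ZMod p) (V := F)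
    rw [hq, Nat.card_zmod] at h
    exact (Nat.pow_right_injective (Fact.out : p.Prime).two_le h).symm
  let σ : F ≃ₐ[ZMod p] F := AlgEquiv.ofRingEquiv (f := θ) fun a =>
    RingHom.congr_fun (RingHom.ext_zmod ((θ : F →+* F).comp (algebraMap (ZMod p) F))
      (algebraMap (ZMod p) F)) a
  have h1 : σ ^ r = 1 := by
    rw [← hr, ← IsGalois.card_aut_eq_finrank, pow_card_eq_one']
  have h2 : ⇑(σ ^ r) = θ^[r] := AlgEquiv.coe_pow σ r
  rw [← h2, h1]
  rfl

theorem iterate_constaShift {R : Type*} [CommRing R] {n : ℕ} [NeZero n] (θ : R ≃+* R) {lam : R}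
    (hθ : θ lam = lam) (t : ℕ) (v : Fin n → R) :
    (constaShift θ lam)^[t] v = shiftMatrix n lam ^ t *ᵥ (θ^[t] ∘ v) := by
  induction t with
  | zero => simp
  | succ t ih =>
    have h1 : (θ : R →+* R).mapMatrix (shiftMatrix n lam ^ t) = shiftMatrix n lam ^ t := by
      rw [map_pow, mapMatrix_shiftMatrix]
      simp [hθ]
    have h2 : θ ∘ (shiftMatrix n lam ^ t *ᵥ (θ^[t] ∘ v)) =
        shiftMatrix n lam ^ t *ᵥ (θ^[t + 1] ∘ v) := by
      conv_rhs => rw [← h1, Function.iterate_succ']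
      funext i
      exact RingHom.map_mulVec (θ : R →+* R) _ _ i
    rw [Function.iterate_succ_apply', ih, constaShift_eq, h2, mulVec_mulVec, ← pow_succ']

/-- If the order of `θ` is prime to `2 m`, a skew constacyclic code of length `m k` is stable under
the `k`-th power of the linear constacyclic shift. -/
theorem IsShiftStable.shiftMatrix_pow_mulVec_mem {F : Type*} [Field F] {m k r : ℕ}
    [NeZero (m * k)] {θ : F ≃+* F} (hr : ∀ x, θ^[r] x = x) (hcop : Nat.Coprime r (2 * m)) {lam : F}
    (hθ : θ lam = lam) (hlam : lam * lam = 1) {C : Submodule F (Fin (m * k) → F)}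
    (hC : IsShiftStable θ lam C) : ∀ v ∈ C, shiftMatrix (m * k) lam ^ k *ᵥ v ∈ C := by
  intro v hv
  have hm : 0 < m := Nat.pos_of_ne_zero fun h => NeZero.ne (m * k) (by simp [h])
  have hφ : (2 * m).totient ≠ 0 := (Nat.totient_pos.2 (by lia)).ne'
  -- `u` is divisible by `r` and is `1` modulo `2 * m`: the `u * k`-th iterate of the shift has no
  -- `θ` left, and its matrix is `P ^ k` since `P ^ (2 * m * k) = 1`.
  set u := r ^ (2 * m).totient with hu
  have hit : ∀ t, (constaShift θ lam)^[t] v ∈ C := by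
    intro t
    induction t with
    | zero => exact hv
    | succ t ih =>
      rw [Function.iterate_succ_apply']
      exact hC _ ih
  have hθu : θ^[u * k] = id := by
    have h1 : θ^[r] = id := funext hr
    obtain ⟨w, hw⟩ : r ∣ u * k := (dvd_pow_self r hφ).mul_right k
    rw [hw, Function.iterate_mul, h1, Function.iterate_id]
  have hu1 : u ≡ 1 [MOD 2 * m] := Nat.ModEq.pow_totient hcop
  have hP : shiftMatrix (m * k) lam ^ (u * k) = shiftMatrix (m * k) lam ^ k := by
    have h2 : shiftMatrix (m * k) lam ^ (2 * m * k) = 1 := by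
      have h : shiftMatrix (m * k) lam ^ (m * k) = lam • 1 := shiftMatrix_pow_self lam
      rw [mul_assoc, mul_comm 2, pow_mul, h, pow_two, smul_mul_smul_comm, hlam]
      simp
    have h3 : u * k ≡ 1 * k [MOD 2 * m * k] := hu1.mul_right' k
    have h4 := pow_eq_pow_of_modEq h3 h2
    rwa [one_mul] at h4
  have h5 := hit (u * k)
  rwa [iterate_constaShift θ hθ, hθu, hP, Function.id_comp] at h5

/-! ### The obstructions in applicable form. -/

section SquareRoot

variable {F : Type*} [Field F] {θ : F ≃+* F} {i : F}

/-- The determinant `d = ± i ^ k` satisfies `θ d = ε ^ k * d`, so `-lam * θ d = d` becomes `-d = d`.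
-/
theorem not_exists_selfDual_of_sqrt (h2 : (2 : F) ≠ 0) (hi : i * i = -1) {k : ℕ}
    [NeZero (2 * k)] {ε lam : F} (hθ : θ i = ε * i) (hlam : lam * lam = 1) (hε : lam * ε ^ k = 1) :
    ¬ ∃ D : Submodule F (Fin (2 * k) → F), IsSelfDual D ∧ IsShiftStable θ lam D := by
  rintro ⟨D, hD, hs⟩
  obtain ⟨d, hd, hd'⟩ := hD.exists_sq_eq_of_isShiftStable hlam hs
  have hd2 : d ^ 2 = (i ^ k) ^ 2 := by
    rw [hd, ← pow_mul, mul_comm, pow_mul, pow_two, hi]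
  have hθd : θ d = ε ^ k * d := by
    rcases sq_eq_sq_iff_eq_or_eq_neg.1 hd2 with rfl | rfl
    · rw [map_pow, hθ, mul_pow]
    · rw [map_neg, map_pow, hθ, mul_pow, mul_neg]
  have hd0 : d ≠ 0 := by
    rintro rfl
    rw [zero_pow two_ne_zero] at hd
    exact pow_ne_zero k (neg_ne_zero.2 (one_ne_zero (α := F))) hd.symm
  rw [hθd] at hd'
  have h3 : 2 * d = 0 := by linear_combination -hd' - d * hε
  exact (mul_ne_zero h2 hd0) h3

end SquareRoot

theorem not_exists_selfDual_of_odd {F : Type*} [Field F] [Finite F] (K : Type*) [Field K]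
    [Algebra F K] [FiniteDimensional F K] (h2 : (2 : F) ≠ 0) {θ : F ≃+* F} {r : ℕ}
    (hr : ∀ x, θ^[r] x = x) (hrodd : Odd r) {lam : F} (hθ : θ lam = lam) (hlam : lam * lam = 1)
    {n a k : ℕ} [NeZero n] (hn : n = 2 ^ (a + 1) * k) (hk : Odd k) {z : K}
    (hz : z ^ 2 ^ (a + 1) = algebraMap F K lam) (hzq : z ^ Nat.card F = z⁻¹) :
    ¬ ∃ D : Submodule F (Fin n → F), IsSelfDual D ∧ IsShiftStable θ lam D := by
  subst hn
  rintro ⟨D, hD, hs⟩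
  refine not_isSelfDual_of_odd hlam hz hzq ?_ hk
    (hs.shiftMatrix_pow_mulVec_mem hr ?_ hθ hlam) hD
  · have h3 : (2 : K) ≠ 0 := by
      rw [← map_ofNat (algebraMap F K)]
      exact (map_ne_zero _).2 h2
    push_cast
    exact pow_ne_zero _ h3
  · rw [← pow_succ']
    exact (Nat.coprime_two_right.2 hrodd).pow_right _

theorem exists_selfDual_of_two_pow_mul {F : Type*} [Field F] {p : ℕ} [Fact p.Prime] [CharP F p]
    (h2 : (2 : F) ≠ 0) (θ : F ≃+* F) {μ c l n : ℕ} (hμ : 2 ≤ μ) (hc : Odd c)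
    (hp : p + 1 = 2 ^ μ * c) [NeZero n] (hn : n = 2 ^ μ * l) :
    ∃ D : Submodule F (Fin n → F), IsSelfDual D ∧ IsShiftStable θ (-1) D := by
  subst hn
  exact exists_selfDual_of_two_pow_dvd h2 θ hμ hc hp

/-- A root of `X ^ 2 ^ (a + 1) + 1` has order dividing `2 ^ (a + 2)`, hence dividing `q + 1`. -/
theorem exists_root_two_pow {F : Type*} [Field F] [Finite F] {a : ℕ}
    (h : 2 ^ (a + 2) ∣ Nat.card F + 1) :
    ∃ z : (Polynomial.X ^ 2 ^ (a + 1) + 1 : Polynomial F).SplittingField,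
      z ^ 2 ^ (a + 1) = algebraMap F _ (-1) ∧ z ^ Nat.card F = z⁻¹ := by
  set f := (Polynomial.X ^ 2 ^ (a + 1) + 1 : Polynomial F) with hf
  have hdeg : f.degree ≠ 0 := by
    rw [hf, ← Polynomial.C_1, Polynomial.degree_X_pow_add_C (by positivity)]
    simp
  obtain ⟨z, hz⟩ := (Polynomial.SplittingField.splits f).exists_eval_eq_zero (by simpa using hdeg)
  have hz1 : z ^ 2 ^ (a + 1) = -1 := by
    rw [eq_neg_iff_add_eq_zero]
    simpa [hf] using hz
  refine ⟨z, by rw [hz1]; simp, ?_⟩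
  obtain ⟨c, hc⟩ := h
  refine eq_inv_of_mul_eq_one_left ?_
  rw [← pow_succ, hc, pow_succ, mul_assoc, pow_mul, hz1, pow_mul]
  simp

theorem apply_sqrt_eq_or {F : Type*} [Field F] {θ : F ≃+* F} {i : F} (hi : i * i = -1) (h2 : (2 : F) ≠ 0) {N : ℕ} (hN : Odd N)
    (hθ : ∀ x : F, θ x = x ↔ x ^ N = x) :
    (θ i = i ∧ N % 4 = 1) ∨ (θ i = -i ∧ N % 4 = 3) := by
  have hi0 : i ≠ 0 := by
    rintro rfl
    simp at hi
  have h4 : i ^ 4 = 1 := by linear_combination (i * i - 1) * hi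
  have hne : -i ≠ i := fun h => mul_ne_zero h2 hi0 (by linear_combination -h)
  have hθi : θ i = i ∨ θ i = -i := by
    refine sq_eq_sq_iff_eq_or_eq_neg.1 ?_
    rw [pow_two, pow_two, ← map_mul, hi, map_neg, map_one]
  have hcases : N % 4 = 1 ∨ N % 4 = 3 := by
    obtain ⟨t, rfl⟩ := hN
    lia
  rcases hcases with h | h
  · refine Or.inl ⟨(hθ i).2 ?_, h⟩
    rw [pow_eq_pow_of_modEq (show N ≡ 1 [MOD 4] from h) h4, pow_one]
  · refine Or.inr ⟨hθi.resolve_left fun h' => hne ?_, h⟩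
    rw [hθ, pow_eq_pow_of_modEq (show N ≡ 3 [MOD 4] from h) h4] at h'
    linear_combination h' - i * hi

theorem pow_mod_four_eq_one_iff {p : ℕ} (hp : p % 4 = 3) (s : ℕ) : p ^ s % 4 = 1 ↔ Even s := by
  rcases Nat.even_or_odd' s with ⟨t, rfl | rfl⟩
  · simp [pow_mul, Nat.pow_mod, hp]
  · simp [pow_succ, pow_mul, Nat.pow_mod, Nat.mul_mod, hp]

/-! ### Assembly of the two residue classes of `q` modulo 4. -/

section Main

variable {F : Type*} [Field F] [Finite F] {p r : ℕ} {θ : F ≃+* F}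

theorem existence_of_card_mod_four_eq_one {s k : ℕ} (h2 : (2 : F) ≠ 0) (hp_odd : Odd p)
    (hq : Nat.card F = p ^ r) (hk : 0 < k) (hθ : ∀ x : F, θ x = x ↔ x ^ p ^ s = x)
    (h1 : Nat.card F ≡ 1 [MOD 4]) :
    (ExistsSelfDualSkewCyclic θ k ↔ p ≡ 3 [MOD 4] ∧ Even r ∧ Odd (s * k)) ∧
    (ExistsSelfDualSkewNegacyclic θ k ↔
      p ≡ 1 [MOD 4] ∨ (p ≡ 3 [MOD 4] ∧ Even r ∧ Even (s * k))) := by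
  have : NeZero (2 * k) := ⟨by lia⟩
  cases nonempty_fintype F
  obtain ⟨i, hi⟩ := FiniteField.isSquare_neg_one_iff.2 (show Fintype.card F % 4 ≠ 3 by
    rw [← Nat.card_eq_fintype_card, h1]
    simp)
  have hpmod : p % 4 = 1 ∨ p % 4 = 3 := by
    obtain ⟨t, rfl⟩ := hp_odd
    lia
  -- The parity condition on `r` is automatic when `q ≡ 1 mod 4` and `p ≡ 3 mod 4`.
  have hr : p % 4 = 3 → Even r := fun h => by
    rw [← pow_mod_four_eq_one_iff h, ← hq]
    exact h1
  rw [existsSelfDualSkewCyclic_iff, existsSelfDualSkewNegacyclic_iff]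
  simp only [Nat.ModEq, Nat.reduceMod]
  rcases apply_sqrt_eq_or hi.symm h2 hp_odd.pow hθ with ⟨hθi, hs⟩ | ⟨hθi, hs⟩
  · have hs' : p % 4 = 3 → Even s := fun h => (pow_mod_four_eq_one_iff h s).1 hs
    have hneg := exists_selfDual_of_fixed_sqrt h2 θ hi.symm hθi k
    have hcyc := not_exists_selfDual_of_sqrt h2 hi.symm (θ := θ) (k := k) (ε := 1) (lam := 1)
      (by rw [hθi, one_mul]) (one_mul 1) (by simp)
    simp only [hneg, hcyc, true_iff, false_iff, Nat.even_mul, ← Nat.not_even_iff_odd]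
    tauto
  · have hp3 : p % 4 = 3 := hpmod.resolve_left fun h => by
      rw [Nat.pow_mod, h] at hs
      simp at hs
    have hs' : Odd s := by
      rw [← Nat.not_even_iff_odd, ← pow_mod_four_eq_one_iff hp3, hs]
      simp
    have hex := exists_selfDual_of_conjugated_sqrt h2 θ hi.symm hθi k
    have hnex := fun lam : F => not_exists_selfDual_of_sqrt h2 hi.symm (θ := θ) (k := k)
      (ε := -1) (lam := lam) (by rw [hθi, neg_one_mul])
    rcases Nat.even_or_odd k with hk' | hk'
    · rw [hk'.add_one.neg_one_pow] at hex
      simp [hex, hnex 1 (by simp) (by rw [hk'.neg_one_pow, one_mul]), hp3, hr hp3, hk',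
        Nat.odd_mul, hs']
    · rw [hk'.add_one.neg_one_pow] at hex
      simp [hex, hnex (-1) (by simp) (by simp [hk'.neg_one_pow]), hp3, hr hp3, hk',
        Nat.even_mul, hs']

theorem existence_of_card_mod_four_eq_three {k : ℕ} [Fact p.Prime] [CharP F p]
    (h2 : (2 : F) ≠ 0) (hp_odd : Odd p) (hq : Nat.card F = p ^ r) (hk : 0 < k)
    (h3 : Nat.card F ≡ 3 [MOD 4]) :
    ¬ ExistsSelfDualSkewCyclic θ k ∧
      ∃ μ : ℕ, 2 ≤ μ ∧ IsGreatest {m : ℕ | 2 ^ m ∣ p + 1} μ ∧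
        (ExistsSelfDualSkewNegacyclic θ k ↔ k ≡ 0 [MOD 2 ^ (μ - 1)]) := by
  have : NeZero (2 * k) := ⟨by lia⟩
  have h3' : p ^ r % 4 = 3 := hq ▸ h3
  have hp3 : p % 4 = 3 := by
    have hpmod : p % 4 = 1 ∨ p % 4 = 3 := by
      obtain ⟨t, rfl⟩ := hp_odd
      lia
    refine hpmod.resolve_left fun h => ?_
    rw [Nat.pow_mod, h] at h3'
    simp at h3'
  have hr : Odd r := by
    rw [← Nat.not_even_iff_odd, ← pow_mod_four_eq_one_iff hp3, h3']
    simp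
  have hθr := iterate_eq_self_of_card hq θ
  obtain ⟨a, k', hk', hak⟩ := Nat.exists_eq_two_pow_mul_odd hk.ne'
  have hn : 2 * k = 2 ^ (a + 1) * k' := by
    rw [hak]
    ring
  obtain ⟨μ, c, hc, hμc⟩ := Nat.exists_eq_two_pow_mul_odd (n := p + 1) (by lia)
  have hdvd : ∀ m, 2 ^ m ∣ p + 1 ↔ m ≤ μ := by
    intro m
    rw [hμc, Nat.Coprime.dvd_mul_right (Nat.Coprime.pow_left _ (Nat.coprime_two_left.2 hc)),
      Nat.pow_dvd_pow_iff_le_right (by norm_num)]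
  have hμ : 2 ≤ μ := (hdvd 2).1 (by lia)
  have hpq : p + 1 ∣ Nat.card F + 1 := by
    rw [hq]
    simpa using hr.nat_add_dvd_pow_add_pow p 1
  rw [existsSelfDualSkewCyclic_iff]
  refine ⟨not_exists_selfDual_of_odd F h2 hθr hr (map_one θ) (one_mul 1) hn hk' (z := 1)
    (by simp) (by simp), μ, hμ, ⟨(hdvd μ).2 le_rfl, fun m hm => (hdvd m).1 hm⟩, ?_⟩
  rw [existsSelfDualSkewNegacyclic_iff, Nat.modEq_zero_iff_dvd]
  constructor
  · intro hex
    by_contra hnd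
    -- `a` is the exponent of 2 in `k`. If `2 ^ (μ - 1)` does not divide `k`, then `2 ^ (a + 2)`
    -- divides `p + 1`, hence `q + 1` because `r` is odd, and the required `z` exists.
    have ha : a + 2 ≤ μ := by
      by_contra hlt
      exact hnd (hak ▸ (pow_dvd_pow 2 (by lia)).mul_right k')
    obtain ⟨z, hz, hzq⟩ := exists_root_two_pow (F := F) (((hdvd (a + 2)).2 ha).trans hpq)
    exact not_exists_selfDual_of_odd _ h2 hθr hr (by simp) (by simp) hn hk' hz hzq hex
  · rintro ⟨l, hl⟩
    refine exists_selfDual_of_two_pow_mul h2 θ hμ hc hμc (l := l) ?_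
    rw [hl, ← mul_assoc, ← pow_succ', Nat.sub_add_cancel (by lia)]

end Main

end SkewCode

theorem proposition4p2 {F : Type*} [Field F] [Finite F] (p r s k : ℕ)
    (hp : p.Prime) (hp_odd : Odd p) (hq : Nat.card F = p ^ r) (hs : s ∣ r) (hk : 0 < k)
    (θ : F ≃+* F) (hθ : ∀ x : F, θ x = x ↔ x ^ p ^ s = x) :
    (Nat.card F ≡ 1 [MOD 4] →
      (SkewCode.ExistsSelfDualSkewCyclic θ k ↔ p ≡ 3 [MOD 4] ∧ Even r ∧ Odd (s * k)) ∧
      (SkewCode.ExistsSelfDualSkewNegacyclic θ k ↔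
        p ≡ 1 [MOD 4] ∨ (p ≡ 3 [MOD 4] ∧ Even r ∧ Even (s * k)))) ∧
    (Nat.card F ≡ 3 [MOD 4] →
      ¬ SkewCode.ExistsSelfDualSkewCyclic θ k ∧
      ∃ μ : ℕ, 2 ≤ μ ∧ IsGreatest {m : ℕ | 2 ^ m ∣ p + 1} μ ∧
        (SkewCode.ExistsSelfDualSkewNegacyclic θ k ↔ k ≡ 0 [MOD 2 ^ (μ - 1)])) := by
  have : Fact p.Prime := ⟨hp⟩
  cases nonempty_fintype F
  have : CharP F p := charP_of_card_eq_prime_pow (by rw [← Nat.card_eq_fintype_card, hq])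
  have h2 : (2 : F) ≠ 0 := Ring.two_ne_zero (by
    rw [ringChar.eq F p]
    rintro rfl
    exact absurd hp_odd (by decide))
  exact ⟨SkewCode.existence_of_card_mod_four_eq_one h2 hp_odd hq hk hθ,
    SkewCode.existence_of_card_mod_four_eq_three h2 hp_odd hq hk⟩
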